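/- \textbf{Setting.} Let $M$ be an asymptotically (locally) anti-de Sitter spacetime of dimension $n+2\ge 2$: $M$ is the interior of a smooth manifold with boundary $\tilde M$ carrying a smooth time-oriented Lorentzian metric $\hat g$ and a smooth function $\Omega$ with $\Omega>0$ on $M$, $\Omega=0$ and $\hat g(d\Omega,d\Omega)=1/L^2$ (for a constant $L>0$) on $\partial\tilde M$; the metric of $M$ is $\Omega^{-2}\hat g$, and $\tilde M$ is globally hyperbolic (causal, with compact causal diamonds). For $s\subset M$ let $s'=M\setminus \mathrm{cl}\,J^+(s)\setminus \mathrm{cl}\,J^-(s)$. A \emph{wedge} is a set $a\subset M$ with $a=a''$; its \emph{edge} is $\eth a=\partial a\cap\partial a'$ (boundaries taken in $M$). A \emph{Cauchy slice} of a wedge $w$ is a closed achronal subset of $\mathrm{cl}\,w$ in $M$ that contains $\eth w$ and whose closure in $\tilde M$ meets every inextendible causal curve of $\tilde M$ through $w$. A \emph{spatial region} $B\subset\partial\tilde M$ is a relatively open subset of a Cauchy surface of $\partial\tilde M$. The \emph{footprint} of a wedge $a$ is the set of points of $\partial\tilde M$ that have a neighbourhood in $\tilde M$ whose part in $M$ lies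 in $a$. The \emph{conformal edge} $\tilde\eth a$ is the region in which Cauchy slices of $a$ end on $\partial\tilde M$, up to the choice of the slice: $\tilde\eth g=\tilde\eth a$ means that the footprints of $g$ and $a$ have the same domain of dependence in $\partial\tilde M$, and $\tilde\eth a=B$ means that $B$ is contained in the footprint of $a$ and has the same domain of dependence in $\partial\tilde M$ as the footprint. In the sets below $\eth a$ and $\tilde\eth a$ together form the completed edge $\bar\eth a=\eth a\cup\tilde\eth a\subset\tilde M$, with $\tilde\eth a$ represented by that domain of dependence. A subset of $\tilde M$ is called \emph{bounded in $M$} if its closure in $\tilde M$ is compact and contained in $M$. Quantum matter on $M$ is given by a (regulated) isotone, local net of von Neumann algebras indexed by wedges, on a Hilbert space with a unit vector as global state, and $S(a)$ is the von Neumann entropy of the state reduced to the algebra of $a$. The \emph{generalized entropy} is $S_{\rm gen}(a)=\mathrm{Area}(\eth a)/(4G\hbar)+S(a)+(\text{counterterms})$ with $S_{\rm gen}(a)=S_{\rm gen}(a')$; in comparing $S_{\rm gen}(h)$ with $S_{\rm gen}(g)$ the area of the common part $\eth h\cap\eth g$ is cancelled. A wedge $g$ is \emph{normal} if at each point of $\eth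 g$ both null expansions exist and are nonnegative; the future (past) expansion is $4G\hbar$ times the functional derivative of $S_{\rm gen}$, per unit area of the edge, under outward deformations of $\eth g$ along the future (past) directed affinely parametrized null geodesics orthogonal to $\eth g$. For a wedge $a$ let $G(a)$ be the set of wedges $g$ such that (i) $g\supset a$ and $\tilde\eth g=\tilde\eth a$; (ii) $g$ is normal; (iii) $g'$ admits a Cauchy slice $\Sigma'$ such that $S_{\rm gen}(h)>S_{\rm gen}(g)$ for every wedge $h\ne g$ with $g\subset h$, $\eth h\subset\Sigma'$, and $\bar\eth h\setminus\bar\eth g$ bounded in $M$. For a spatial region $B$ of $\partial\tilde M$ let $G(B)$ be the set of wedges $g$ such that (i) $\tilde\eth g=B$; (ii) $g$ is normal; (iii) $g'$ admits a Cauchy slice $\Sigma'$ such that $S_{\rm gen}(h)>S_{\rm gen}(g)$ for every wedge $h\ne g$ with $g\subset h$, $\tilde\eth h=B$, $\eth h\subset\Sigma'$, and $\eth h\setminus\eth g$ bounded in $M$. The \emph{min-entanglement wedges} are $e_{\min}(a)=\bigcap_{g\in G(a)}g$ and $\mathrm{minEW}(B)=\bigcap_{g\in G(B)}g$ (the intersection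 of an empty family being $M$). \textbf{Theorem.} Let $a$ be a wedge and let $B$ be a spatial region of $\partial\tilde M$ with $\tilde\eth a=B$. If $a\subset\mathrm{minEW}(B)$, then $G(a)=G(B)$, and hence $e_{\min}(a)=\mathrm{minEW}(B)$. -/

import Mathlib

open Set Filter Topology MeasureTheory Manifold
open scoped ContDiff ENNReal

noncomputable section

namespace Holo

/-! ## Spacetime and its conformal completion -/

/-- A time-oriented Lorentzian spacetime together with its conformal completion.
The carrier `X` is the completed (unphysical) spacetime, a smooth manifold with boundary of
dimension `n + 2`; the physical spacetime is the interior of `X` with the metric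
`Ω⁻² ĝ`, where `ĝ = unphys` is a smooth Lorentzian metric on `X` (signature `- + ⋯ +`). -/
structure Spacetime (n : ℕ) (X : Type*) [TopologicalSpace X]
    [ChartedSpace (EuclideanHalfSpace (n + 2)) X] [IsManifold (𝓡∂ (n + 2)) ∞ X] where
  /-- the unphysical metric -/
  unphys : ∀ x : X, TangentSpace (𝓡∂ (n + 2)) x →L[ℝ] TangentSpace (𝓡∂ (n + 2)) x →L[ℝ] ℝ
  unphys_symm : ∀ x v w, unphys x v w = unphys x w v
  unphys_smooth : ContMDiff (𝓡∂ (n + 2))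
    ((𝓡∂ (n + 2)).prod 𝓘(ℝ, EuclideanSpace ℝ (Fin (n + 2)) →L[ℝ]
      EuclideanSpace ℝ (Fin (n + 2)) →L[ℝ] ℝ)) ∞
    (fun x ↦ Bundle.TotalSpace.mk'
      (EuclideanSpace ℝ (Fin (n + 2)) →L[ℝ] EuclideanSpace ℝ (Fin (n + 2)) →L[ℝ] ℝ)
      (E := fun x : X ↦ TangentSpace (𝓡∂ (n + 2)) x →L[ℝ] TangentSpace (𝓡∂ (n + 2)) x →L[ℝ] ℝ)
      x (unphys x))
  /-- a continuous timelike vector field, the time orientation -/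
  time : ∀ x : X, TangentSpace (𝓡∂ (n + 2)) x
  time_continuous : Continuous (fun x ↦ (⟨x, time x⟩ : TangentBundle (𝓡∂ (n + 2)) X))
  time_timelike : ∀ x, unphys x (time x) (time x) < 0
  /-- Lorentzian signature: the orthogonal complement of a timelike vector is spacelike -/
  lorentzian : ∀ x v, unphys x (time x) v = 0 → v ≠ 0 → 0 < unphys x v v
  /-- the conformal factor -/
  Ω : X → ℝ
  Ω_smooth : ContMDiff (𝓡∂ (n + 2)) 𝓘(ℝ, ℝ) ∞ Ω
  Ω_pos : ∀ x ∈ (𝓡∂ (n + 2)).interior X, 0 < Ω x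
  Ω_zero : ∀ x ∈ (𝓡∂ (n + 2)).boundary X, Ω x = 0

/-- The two time directions. -/
inductive TimeDir
  | future
  | past

namespace Spacetime

variable {n : ℕ} {X : Type*} [TopologicalSpace X]
    [ChartedSpace (EuclideanHalfSpace (n + 2)) X] [IsManifold (𝓡∂ (n + 2)) ∞ X]
    (S : Spacetime n X)

/-- The physical spacetime `M`, as a subset of its completion. -/
def bulk (_S : Spacetime n X) : Set X := (𝓡∂ (n + 2)).interior X

/-- The conformal boundary. -/
def bdry (_S : Spacetime n X) : Set X := (𝓡∂ (n + 2)).boundary X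

/-- The physical metric `g = Ω⁻² ĝ` (used at points of the bulk only). -/
def metric (x : X) (v w : TangentSpace (𝓡∂ (n + 2)) x) : ℝ :=
  (S.Ω x ^ 2)⁻¹ * S.unphys x v w

/-- Future-directed causal vectors. Causality is conformally invariant, so the unphysical metric
can be used. -/
def FutureCausal {x : X} (v : TangentSpace (𝓡∂ (n + 2)) x) : Prop :=
  v ≠ 0 ∧ S.unphys x v v ≤ 0 ∧ S.unphys x (S.time x) v < 0

/-- Future-directed timelike vectors. -/
def FutureTimelike {x : X} (v : TangentSpace (𝓡∂ (n + 2)) x) : Prop :=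
  S.unphys x v v < 0 ∧ S.unphys x (S.time x) v < 0

/-! ## Causal structure

The causal relations are those generated by curves that stay in a region `R` of the completion:
`R = bulk` gives the causal structure of `M`, `R = bdry` that of the conformal boundary, and
`R = univ` that of the completion. -/

/-- There is a `C¹` future-directed causal curve in `R` from `p` to `q`. -/
def CausalSegment (R : Set X) (p q : X) : Prop :=
  ∃ γ : ℝ → X, ContMDiffOn 𝓘(ℝ, ℝ) (𝓡∂ (n + 2)) 1 γ (Icc 0 1) ∧ MapsTo γ (Icc 0 1) R ∧
    γ 0 = p ∧ γ 1 = q ∧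
    ∀ t ∈ Icc (0 : ℝ) 1,
      S.FutureCausal (mfderivWithin 𝓘(ℝ, ℝ) (𝓡∂ (n + 2)) γ (Icc 0 1) t (1 : ℝ))

/-- There is a `C¹` future-directed timelike curve in `R` from `p` to `q`. -/
def TimelikeSegment (R : Set X) (p q : X) : Prop :=
  ∃ γ : ℝ → X, ContMDiffOn 𝓘(ℝ, ℝ) (𝓡∂ (n + 2)) 1 γ (Icc 0 1) ∧ MapsTo γ (Icc 0 1) R ∧
    γ 0 = p ∧ γ 1 = q ∧
    ∀ t ∈ Icc (0 : ℝ) 1,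
      S.FutureTimelike (mfderivWithin 𝓘(ℝ, ℝ) (𝓡∂ (n + 2)) γ (Icc 0 1) t (1 : ℝ))

/-- `q ∈ J⁺(p)` in `R`: equal points, or a piecewise `C¹` causal curve from `p` to `q`. -/
def CausalRel (R : Set X) : X → X → Prop := Relation.ReflTransGen (S.CausalSegment R)

/-- `q ∈ I⁺(p)` in `R`: a piecewise `C¹` timelike curve from `p` to `q`. -/
def ChronRel (R : Set X) : X → X → Prop := Relation.TransGen (S.TimelikeSegment R)

/-- Causal future `J⁺(s)` in `M`. -/
def causalFuture (s : Set X) : Set X := {q | ∃ p ∈ s, S.CausalRel S.bulk p q}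

/-- Causal past `J⁻(s)` in `M`. -/
def causalPast (s : Set X) : Set X := {q | ∃ p ∈ s, S.CausalRel S.bulk q p}

/-- No two points of `A` are joined by a timelike curve in `R`. -/
def Achronal (R A : Set X) : Prop := ∀ p ∈ A, ∀ q ∈ A, ¬ S.ChronRel R p q

/-- An inextendible (continuous, future-directed) causal curve in `R`: it has neither a future
nor a past endpoint in `R`. -/
def IsInextendibleCausal (R : Set X) (γ : ℝ → X) : Prop :=
  Continuous γ ∧ (∀ t, γ t ∈ R) ∧
    (∀ s t, s < t → γ s ≠ γ t ∧ S.CausalRel R (γ s) (γ t)) ∧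
    (¬ ∃ p ∈ R, Tendsto γ atTop (𝓝 p)) ∧ ¬ ∃ p ∈ R, Tendsto γ atBot (𝓝 p)

/-- Domain of dependence of `A` in `R`. -/
def domDep (R A : Set X) : Set X :=
  {p | p ∈ R ∧ ∀ γ : ℝ → X, S.IsInextendibleCausal R γ → (∃ s, γ s = p) → ∃ t, γ t ∈ A}

/-- `M` is asymptotically (locally) anti-de Sitter, and globally hyperbolic in the sense
appropriate to a spacetime with timelike conformal boundary.
In `boundary_normal`, `N` is the gradient of `Ω` for the unphysical metric; the condition
`ĝ(dΩ,dΩ) = 1/L² > 0` makes the boundary timelike, forces `dΩ ≠ 0` there, and says that the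
curvature of `M` approaches that of anti-de Sitter space of radius `L`. -/
structure IsAsymptoticallyAdS : Prop where
  boundary_normal : ∃ L : ℝ, 0 < L ∧ ∀ x ∈ S.bdry, ∀ N : TangentSpace (𝓡∂ (n + 2)) x,
    (∀ v : TangentSpace (𝓡∂ (n + 2)) x,
      S.unphys x N v = (mfderiv (𝓡∂ (n + 2)) 𝓘(ℝ, ℝ) S.Ω x v : ℝ)) →
    (mfderiv (𝓡∂ (n + 2)) 𝓘(ℝ, ℝ) S.Ω x N : ℝ) = 1 / L ^ 2
  causal : ∀ p q, S.CausalRel univ p q → S.CausalRel univ q p → p = q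
  diamonds_compact : ∀ p q, IsCompact {r | S.CausalRel univ p r ∧ S.CausalRel univ r q}

/-! ## Wedges and edges -/

/-- Spacelike complement `s' = M \ cl J⁺(s) \ cl J⁻(s)`. -/
def compl (s : Set X) : Set X :=
  (S.bulk \ closure (S.causalFuture s)) \ closure (S.causalPast s)

/-- A wedge is a subset of `M` equal to its double spacelike complement. -/
def IsWedge (a : Set X) : Prop := a ⊆ S.bulk ∧ S.compl (S.compl a) = a

/-- The edge `∂a ∩ ∂a'` (boundaries in `M`). -/
def edge (a : Set X) : Set X := S.bulk ∩ frontier a ∩ frontier (S.compl a)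

/-- The footprint of `a` on the conformal boundary: the boundary points that have a neighbourhood
whose bulk part lies in `a`. -/
def footprint (a : Set X) : Set X := {q | q ∈ S.bdry ∧ a ∈ 𝓝[S.bulk] q}

/-- The conformal edge of `a`. A Cauchy slice of an asymptotic wedge `a` ends on the conformal
boundary in a spatial region, which is determined by `a` only up to the choice of the slice. What
all these regions have in common is their domain of dependence in the conformal boundary,
and this set represents the conformal edge. -/
def confEdge (a : Set X) : Set X := S.domDep S.bdry (S.footprint a)

/-- The edge of `a` as a subset of the conformal completion. -/
def fullEdge (a : Set X) : Set X := S.edge a ∪ S.confEdge a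

/-- `C` is a Cauchy surface of the conformal boundary. -/
def IsBdryCauchySurface (C : Set X) : Prop :=
  C ⊆ S.bdry ∧ IsClosed C ∧ S.Achronal S.bdry C ∧ S.domDep S.bdry C = S.bdry

/-- A spatial region (partial Cauchy surface) of the conformal boundary: a relatively open subset
of a Cauchy surface of the boundary. -/
def IsSpatialRegion (B : Set X) : Prop :=
  ∃ C, S.IsBdryCauchySurface C ∧ ∃ O, IsOpen O ∧ B = C ∩ O

/-- The conformal edge of `a` is the spatial region `B`: the wedge is anchored at `B`, and its
conformal edge is represented by `B`. -/
def HasConfEdge (a B : Set X) : Prop := B ⊆ S.footprint a ∧ S.confEdge a = S.domDep S.bdry B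

/-- `C` is a Cauchy slice of the wedge `w`: a closed achronal subset of the closure of `w` in `M`,
containing the edge of `w`, and met by every inextendible causal curve through `w`. The curves
range over the completion, where they are continued beyond points of the timelike boundary; they
may therefore meet the slice at its limit points on the conformal boundary. -/
def IsCauchySlice (w C : Set X) : Prop :=
  C ⊆ S.bulk ∧ closure C ∩ S.bulk ⊆ C ∧ S.Achronal S.bulk C ∧ C ⊆ closure w ∧ S.edge w ⊆ C ∧
    w ⊆ S.domDep univ (closure C)

/-- `A` has compact closure, contained in `M`. -/
def CompactInBulk (A : Set X) : Prop := IsCompact (closure A) ∧ closure A ⊆ S.bulk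

/-! ## Area -/

/-- Gram matrix, for the physical metric, of the coordinate vectors of a parametrized
`n`-dimensional surface. -/
def gram (φ : EuclideanSpace ℝ (Fin n) → X) (u : EuclideanSpace ℝ (Fin n)) :
    Matrix (Fin n) (Fin n) ℝ := fun i j ↦
  S.metric (φ u)
    (mfderiv 𝓘(ℝ, EuclideanSpace ℝ (Fin n)) (𝓡∂ (n + 2)) φ u (EuclideanSpace.single i (1 : ℝ)))
    (mfderiv 𝓘(ℝ, EuclideanSpace ℝ (Fin n)) (𝓡∂ (n + 2)) φ u (EuclideanSpace.single j (1 : ℝ)))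

/-- The area density `√|det|` of the induced metric. -/
def areaDensity (φ : EuclideanSpace ℝ (Fin n) → X) (u : EuclideanSpace ℝ (Fin n)) : ℝ :=
  Real.sqrt |(S.gram φ u).det|

/-- A measurable piece `D` of a parametrized `C¹` surface of codimension two in `M`. -/
structure Patch where
  map : EuclideanSpace ℝ (Fin n) → X
  U : Set (EuclideanSpace ℝ (Fin n))
  isOpen_U : IsOpen U
  D : Set (EuclideanSpace ℝ (Fin n))
  measurable_D : MeasurableSet D
  D_subset : D ⊆ U
  contMDiffOn : ContMDiffOn 𝓘(ℝ, EuclideanSpace ℝ (Fin n)) (𝓡∂ (n + 2)) 1 map U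
  mapsTo : MapsTo map U S.bulk

/-- Area of a patch. -/
def Patch.area (P : S.Patch) : ℝ≥0∞ := ∫⁻ u in P.D, ENNReal.ofReal (S.areaDensity P.map u)

/-- `N` is negligible for `n`-dimensional measure, in every chart. -/
def Negligible (_S : Spacetime n X) (N : Set X) : Prop :=
  ∀ x : X, μH[(n : ℝ)] (extChartAt (𝓡∂ (n + 2)) x '' (N ∩ (extChartAt (𝓡∂ (n + 2)) x).source)) = 0

/-- The codimension-two area of a subset of `M`: the infimum of the total area of countable
families of patches that cover it up to a negligible set. It is the usual area on (countably)
rectifiable sets, and infinite on sets that are not rectifiable. -/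
def area (E : Set X) : ℝ≥0∞ :=
  ⨅ (P : ℕ → S.Patch) (N : Set X) (_ : S.Negligible N) (_ : E ⊆ N ∪ ⋃ i, (P i).map '' (P i).D),
    ∑' i, (P i).area

/-! ## Null congruences orthogonal to the edge -/

/-- The physical metric in the chart at `x`, evaluated at the coordinate point `y`. -/
def chartMetric (x : X) (y v w : EuclideanSpace ℝ (Fin (n + 2))) : ℝ :=
  S.metric ((extChartAt (𝓡∂ (n + 2)) x).symm y)
    (mfderivWithin 𝓘(ℝ, EuclideanSpace ℝ (Fin (n + 2))) (𝓡∂ (n + 2))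
      (extChartAt (𝓡∂ (n + 2)) x).symm (range (𝓡∂ (n + 2))) y v)
    (mfderivWithin 𝓘(ℝ, EuclideanSpace ℝ (Fin (n + 2))) (𝓡∂ (n + 2))
      (extChartAt (𝓡∂ (n + 2)) x).symm (range (𝓡∂ (n + 2))) y w)

/-- The affinely parametrized geodesic equation for a smooth curve `γ` at the time `t₀`, in the
chart at `γ t₀`: `d/dt (g_{ij} ẏʲ) = ½ ∂ᵢ g_{jk} ẏʲ ẏᵏ`. -/
def GeodesicAt (γ : ℝ → X) (t₀ : ℝ) : Prop :=
  let y : ℝ → EuclideanSpace ℝ (Fin (n + 2)) := fun t ↦ extChartAt (𝓡∂ (n + 2)) (γ t₀) (γ t)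
  ∀ v : EuclideanSpace ℝ (Fin (n + 2)),
    HasDerivAt (fun t ↦ S.chartMetric (γ t₀) (y t) (deriv y t) v)
      (2⁻¹ * deriv (fun r : ℝ ↦
        S.chartMetric (γ t₀) (y t₀ + r • v) (deriv y t₀) (deriv y t₀)) 0) t₀

/-- `φ : U → M` parametrizes the part of the edge of `a` in the open set `V` as a smooth embedded
spacelike surface of codimension two. -/
structure IsEdgeParam (a : Set X) (φ : EuclideanSpace ℝ (Fin n) → X)
    (U : Set (EuclideanSpace ℝ (Fin n))) (V : Set X) : Prop where
  isOpen_U : IsOpen U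
  isOpen_V : IsOpen V
  smooth : ContMDiffOn 𝓘(ℝ, EuclideanSpace ℝ (Fin n)) (𝓡∂ (n + 2)) ∞ φ U
  embedding : IsEmbedding (U.domRestrict φ)
  image : φ '' U = S.edge a ∩ V
  spacelike : ∀ u ∈ U, (S.gram φ u).PosDef

/-- `v` is a null vector pointing in the time direction `σ`. -/
def IsNullDir (σ : TimeDir) {x : X} (v : TangentSpace (𝓡∂ (n + 2)) x) : Prop :=
  S.unphys x v v = 0 ∧
    match σ with
    | .future => S.FutureCausal v
    | .past => S.FutureCausal (-v)

/-- `Φ u t` (`u ∈ U`, `|t| < ε`) is the outward null geodesic congruence, in the time direction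
`σ`, orthogonal to the part of the edge of `a` parametrized by `φ`; `t` is an affine parameter.
Outward means that the geodesics leave the closure of `a`. -/
structure IsNullCongruence (σ : TimeDir) (a : Set X) (φ : EuclideanSpace ℝ (Fin n) → X)
    (U : Set (EuclideanSpace ℝ (Fin n))) (ε : ℝ)
    (Φ : EuclideanSpace ℝ (Fin n) → ℝ → X) : Prop where
  start : ∀ u ∈ U, Φ u 0 = φ u
  mem_bulk : ∀ u ∈ U, ∀ t ∈ Ioo (-ε) ε, Φ u t ∈ S.bulk
  smooth : ContMDiffOn 𝓘(ℝ, EuclideanSpace ℝ (Fin n) × ℝ) (𝓡∂ (n + 2)) ∞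
    (fun z : EuclideanSpace ℝ (Fin n) × ℝ ↦ Φ z.1 z.2) (U ×ˢ Ioo (-ε) ε)
  geodesic : ∀ u ∈ U, ∀ t ∈ Ioo (-ε) ε, S.GeodesicAt (Φ u) t
  null : ∀ u ∈ U, S.IsNullDir σ (mfderiv 𝓘(ℝ, ℝ) (𝓡∂ (n + 2)) (Φ u) 0 (1 : ℝ))
  orthogonal : ∀ u ∈ U, ∀ v : EuclideanSpace ℝ (Fin n),
    S.metric (Φ u 0) (mfderiv 𝓘(ℝ, ℝ) (𝓡∂ (n + 2)) (Φ u) 0 (1 : ℝ))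
      (mfderiv 𝓘(ℝ, EuclideanSpace ℝ (Fin n)) (𝓡∂ (n + 2)) (fun u' ↦ Φ u' 0) u v) = 0
  outward : ∀ u ∈ U, ∀ t ∈ Ioo 0 ε, Φ u t ∉ closure a

/-- The wedge obtained from `a` by pushing its edge outward along the congruence `Φ`, by the
affine distance `f u` along the generator through `φ u`: the smallest wedge containing `a` and the
generators up to that distance. -/
def deform (a : Set X) (U : Set (EuclideanSpace ℝ (Fin n)))
    (Φ : EuclideanSpace ℝ (Fin n) → ℝ → X) (f : EuclideanSpace ℝ (Fin n) → ℝ) : Set X :=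
  S.compl (S.compl (a ∪ {x | ∃ u ∈ U, ∃ t ∈ Icc 0 (f u), Φ u t = x}))

end Spacetime

/-! ## Von Neumann entropy -/

section Entropy

variable {H : Type*} [NormedAddCommGroup H] [InnerProductSpace ℂ H] [CompleteSpace H]

/-- The states (normalized positive linear functionals) of a von Neumann algebra. -/
def states (N : VonNeumannAlgebra H) : Set (N.toStarSubalgebra →ₗ[ℂ] ℂ) :=
  {φ | φ 1 = 1 ∧ ∀ A : N.toStarSubalgebra, 0 ≤ (φ (star A * A)).re ∧ (φ (star A * A)).im = 0}

/-- The pure states: the extreme points of the set of states. -/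
def pureStates (N : VonNeumannAlgebra H) : Set (N.toStarSubalgebra →ₗ[ℂ] ℂ) :=
  extremePoints ℝ (states N)

/-- The functional `A ↦ ⟨ψ, A ψ⟩` on a von Neumann algebra: the reduced state. -/
def reducedState (N : VonNeumannAlgebra H) (ψ : H) : N.toStarSubalgebra →ₗ[ℂ] ℂ where
  toFun A := inner ℂ ψ ((A : H →L[ℂ] H) ψ)
  map_add' A B := by simp
  map_smul' c A := by simp

/-- The von Neumann entropy of a state on a von Neumann algebra: the least Shannon entropy of its
decompositions `φ = ∑ λᵢ φᵢ` into pure states (`⊤` if there is none). On the algebra of all bounded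
operators of a Hilbert space this is `-Tr ρ log ρ`, the infimum being attained at the spectral
decomposition of the density operator `ρ` of a normal state. -/
def vonNeumannEntropy (N : VonNeumannAlgebra H) (φ : N.toStarSubalgebra →ₗ[ℂ] ℂ) : ℝ≥0∞ :=
  ⨅ (w : ℕ → ℝ) (χ : ℕ → (N.toStarSubalgebra →ₗ[ℂ] ℂ)) (_ : ∀ i, 0 ≤ w i) (_ : HasSum w 1)
    (_ : ∀ i, χ i ∈ pureStates N) (_ : ∀ A, HasSum (fun i ↦ (w i : ℂ) * χ i A) (φ A)),
    ∑' i, ENNReal.ofReal (Real.negMulLog (w i))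

end Entropy

/-! ## Quantum matter and generalized entropy -/

/-- The quantum matter on the spacetime `S`: a (regulated) net of von Neumann algebras on a
Hilbert space `H`, indexed by wedges, in a global pure state; together with Newton's and Planck's
constants and the gravitational counterterms of the generalized entropy. -/
structure Matter {n : ℕ} {X : Type*} [TopologicalSpace X]
    [ChartedSpace (EuclideanHalfSpace (n + 2)) X] [IsManifold (𝓡∂ (n + 2)) ∞ X]
    (S : Spacetime n X)
    (H : Type*) [NormedAddCommGroup H] [InnerProductSpace ℂ H] [CompleteSpace H] where
  newton : ℝ
  newton_pos : 0 < newton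
  hbar : ℝ
  hbar_pos : 0 < hbar
  /-- the algebra of the matter fields in a wedge -/
  algebra : Set X → VonNeumannAlgebra H
  isotone : ∀ a b, S.IsWedge a → S.IsWedge b → a ⊆ b → algebra a ≤ algebra b
  /-- observables in spacelike separated wedges commute -/
  local_comm : ∀ a, S.IsWedge a → algebra (S.compl a) ≤ (algebra a).commutant
  /-- the global state vector -/
  ψ : H
  norm_ψ : ‖ψ‖ = 1
  /-- the counterterms -/
  counter : Set X → ℝ
  /-- global purity: since a wedge and its complement have the same edge, this says that they have
  the same generalized entropy -/
  purity : ∀ a, S.IsWedge a →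
    (vonNeumannEntropy (algebra a) (reducedState (algebra a) ψ) : EReal) + (counter a : EReal) =
    (vonNeumannEntropy (algebra (S.compl a)) (reducedState (algebra (S.compl a)) ψ) : EReal) +
      (counter (S.compl a) : EReal)

namespace Matter

variable {n : ℕ} {X : Type*} [TopologicalSpace X]
    [ChartedSpace (EuclideanHalfSpace (n + 2)) X] [IsManifold (𝓡∂ (n + 2)) ∞ X]
    {S : Spacetime n X}
    {H : Type*} [NormedAddCommGroup H] [InnerProductSpace ℂ H] [CompleteSpace H]
    (Q : Matter S H)

/-- The entropy of the matter fields in the wedge `a`. -/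
def matterEntropy (a : Set X) : ℝ≥0∞ :=
  vonNeumannEntropy (Q.algebra a) (reducedState (Q.algebra a) Q.ψ)

/-- `Area(E) / 4Għ + S(a) + counterterms`. For `E` the whole edge of `a` this is the generalized
entropy of `a`. -/
def entropyWith (E a : Set X) : EReal :=
  ((S.area E / ENNReal.ofReal (4 * Q.newton * Q.hbar) : ℝ≥0∞) : EReal) +
    (Q.matterEntropy a : EReal) + (Q.counter a : EReal)

/-- The generalized entropy. -/
def genEntropy (a : Set X) : EReal := Q.entropyWith (S.edge a) a

/-- The difference `S_gen(h) - S_gen(g)`. The area of the common part of the two edges, which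
is infinite for asymptotic wedges, has been cancelled. -/
def entropyDiff (h g : Set X) : EReal :=
  Q.entropyWith (S.edge h \ S.edge g) h - Q.entropyWith (S.edge g \ S.edge h) g

/-- `S_gen(g) < S_gen(h)`. -/
def EntropyLT (g h : Set X) : Prop := 0 < Q.entropyDiff h g

/-- The expansion of `a` at the point `p` of its edge, in the time direction `σ`, exists and has
the value `θ`. It is `4Għ` times the functional derivative of the generalized entropy,
per unit area of the edge, with respect to outward deformations along the orthogonal null
congruence: near `p` there is a continuous density `Θ` such that for each nonnegative profile `f`
`d/ds S_gen(a_{s f}) = (1 / 4Għ) ∫ f Θ dA` at `s = 0+`. (The affine parameter, hence the value of the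
expansion but not its sign, is fixed up to a positive factor on each generator.) -/
def HasExpansion (σ : TimeDir) (a : Set X) (p : X) (θ : ℝ) : Prop :=
  ∃ (φ : EuclideanSpace ℝ (Fin n) → X) (U : Set (EuclideanSpace ℝ (Fin n))) (V : Set X)
    (ε : ℝ) (Φ : EuclideanSpace ℝ (Fin n) → ℝ → X) (Θ : EuclideanSpace ℝ (Fin n) → ℝ),
    S.IsEdgeParam a φ U V ∧ 0 < ε ∧ S.IsNullCongruence σ a φ U ε Φ ∧ ContinuousOn Θ U ∧
    (∃ u ∈ U, φ u = p ∧ Θ u = θ) ∧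
    ∀ f : EuclideanSpace ℝ (Fin n) → ℝ, ContDiff ℝ ∞ f → HasCompactSupport f → tsupport f ⊆ U →
      (∀ u, 0 ≤ f u) →
      Tendsto (fun s : ℝ ↦
          Q.entropyDiff (S.deform a U Φ (fun u ↦ s * f u)) a * ((s⁻¹ : ℝ) : EReal))
        (𝓝[>] 0)
        (𝓝 (((4 * Q.newton * Q.hbar)⁻¹ * ∫ u in U, f u * Θ u * S.areaDensity φ u : ℝ) : EReal))

/-- `a` is normal: both outward null expansions are nonnegative at all points of its edge. -/
def IsNormal (a : Set X) : Prop :=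
  ∀ p ∈ S.edge a, ∀ σ : TimeDir, ∃ θ : ℝ, Q.HasExpansion σ a p θ ∧ 0 ≤ θ

/-! ## Min-entanglement wedges -/

/-- The family `G(a)` for a bulk wedge `a`. -/
def bulkFamily (a : Set X) : Set (Set X) :=
  {g | S.IsWedge g ∧ (a ⊆ g ∧ S.confEdge g = S.confEdge a) ∧ Q.IsNormal g ∧
    ∃ C, S.IsCauchySlice (S.compl g) C ∧
      ∀ h, S.IsWedge h → h ≠ g → g ⊆ h → S.edge h ⊆ C →
        S.CompactInBulk (S.fullEdge h \ S.fullEdge g) → Q.EntropyLT g h}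

/-- The min-entanglement wedge `e_min(a)` of a bulk wedge: the intersection, in `M`, of the
family `G(a)`. -/
def eMin (a : Set X) : Set X := {x | x ∈ S.bulk ∧ ∀ g ∈ Q.bulkFamily a, x ∈ g}

/-- The family `G(B)` for a spatial region `B` of the conformal boundary. The entropies of `g`
and `h` are compared when `h` contains `g` and their edges differ in a bounded region only. -/
def bdryFamily (B : Set X) : Set (Set X) :=
  {g | S.IsWedge g ∧ S.HasConfEdge g B ∧ Q.IsNormal g ∧
    ∃ C, S.IsCauchySlice (S.compl g) C ∧
      ∀ h, S.IsWedge h → h ≠ g → g ⊆ h → S.HasConfEdge h B → S.edge h ⊆ C →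
        S.CompactInBulk (S.edge h \ S.edge g) → Q.EntropyLT g h}

/-- The min-entanglement wedge `minEW(B)` of a boundary region: the intersection, in `M`, of the
family `G(B)`. -/
def minEW (B : Set X) : Set X := {x | x ∈ S.bulk ∧ ∀ g ∈ Q.bdryFamily B, x ∈ g}

end Matter

end Holo

end

namespace Holo

namespace Spacetime

variable {n : ℕ} {X : Type*} [TopologicalSpace X]
    [ChartedSpace (EuclideanHalfSpace (n + 2)) X] [IsManifold (𝓡∂ (n + 2)) ∞ X]
    (S : Spacetime n X)

/-! The core is `mem_bulkFamily_iff`: when `a` is anchored at `B`, the family `G(a)` is exactly the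
set of those `g ∈ G(B)` that contain `a`. The hypothesis `a ⊆ minEW(B)` says that every member of
`G(B)` contains `a`, so the two families coincide, and so do their intersections.

Normality and the entropy inequality are literally the same in both families; the anchoring of `g`
and the class of competitors `h` are phrased differently. `G(B)` demands that `h` be anchored at
`B`, while `G(a)` only bounds the difference of completed edges. These agree because conformal edges
consist of boundary points, and a set bounded in `M` contains none: boundedness of the completed
difference forces `confEdge h ⊆ confEdge g`, and `g ⊆ h` gives the converse
(`compactInBulk_fullEdge_diff_iff`). By `HasConfEdge.iff_of_subset`, applied to `a ⊆ g` and to `g ⊆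
h`, equal conformal edges then mean anchoring at the same `B`. -/

theorem disjoint_bulk_bdry : Disjoint S.bulk S.bdry :=
  ModelWithCorners.disjoint_interior_boundary

theorem edge_subset_bulk (a : Set X) : S.edge a ⊆ S.bulk := fun _ hx ↦ hx.1.1

theorem domDep_mono (R : Set X) {A A' : Set X} (h : A ⊆ A') : S.domDep R A ⊆ S.domDep R A' :=
  fun _ hp ↦ ⟨hp.1, fun γ hγ hs ↦ (hp.2 γ hγ hs).imp fun _ ht ↦ h ht⟩

theorem confEdge_subset_bdry (a : Set X) : S.confEdge a ⊆ S.bdry := fun _ hx ↦ hx.1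

theorem footprint_mono {a b : Set X} (h : a ⊆ b) : S.footprint a ⊆ S.footprint b :=
  fun _ hq ↦ ⟨hq.1, mem_of_superset hq.2 h⟩

/-- For nested wedges one inclusion of conformal edges is thus automatic, and only the opposite one
has to come from boundedness. -/
theorem confEdge_mono {a b : Set X} (h : a ⊆ b) : S.confEdge a ⊆ S.confEdge b :=
  S.domDep_mono _ (S.footprint_mono h)

/-- The edge in the bulk and the conformal edge do not interfere. -/
theorem fullEdge_diff_fullEdge (g h : Set X) :
    S.fullEdge h \ S.fullEdge g = (S.edge h \ S.edge g) ∪ (S.confEdge h \ S.confEdge g) := by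
  -- Two independent sets are needed: the cross terms pair the bulk edge of one wedge with the
  -- conformal edge of the other. They matter only for the inclusion from right to left.
  have key (b c : Set X) : Disjoint (S.edge b) (S.confEdge c) :=
    S.disjoint_bulk_bdry.mono (S.edge_subset_bulk b) (S.confEdge_subset_bdry c)
  ext x
  have h₁ : x ∈ S.edge h → x ∉ S.confEdge g := fun hx hx' ↦ disjoint_left.1 (key h g) hx hx'
  have h₂ : x ∈ S.edge g → x ∉ S.confEdge h := fun hx hx' ↦ disjoint_left.1 (key g h) hx hx'
  simp only [fullEdge, Set.mem_sdiff, mem_union]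
  tauto

/-- The completed edges of nested wedges differ in a bounded region iff their edges do and their
conformal edges agree. -/
theorem compactInBulk_fullEdge_diff_iff {g h : Set X} (hgh : g ⊆ h) :
    S.CompactInBulk (S.fullEdge h \ S.fullEdge g) ↔
      S.confEdge h = S.confEdge g ∧ S.CompactInBulk (S.edge h \ S.edge g) := by
  have eq_diff (he : S.confEdge h = S.confEdge g) :
      S.fullEdge h \ S.fullEdge g = S.edge h \ S.edge g := by
    rw [fullEdge_diff_fullEdge, he, sdiff_self, union_empty]
  constructor
  · intro hc
    have he : S.confEdge h = S.confEdge g := by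
      refine Subset.antisymm (fun x hx ↦ ?_) (S.confEdge_mono hgh)
      -- An excess point of `confEdge h` would lie in the difference of completed edges, whose
      -- closure is contained in the bulk; but it is a boundary point.
      by_contra hxg
      have hx' : x ∈ S.fullEdge h \ S.fullEdge g := by
        rw [fullEdge_diff_fullEdge]
        exact Or.inr ⟨hx, hxg⟩
      exact disjoint_left.1 S.disjoint_bulk_bdry (hc.2 (subset_closure hx'))
        (S.confEdge_subset_bdry h hx)
    exact ⟨he, eq_diff he ▸ hc⟩
  · rintro ⟨he, hc⟩
    rwa [eq_diff he]

/-- A wedge containing a wedge anchored at `B` is anchored at `B` iff the conformal edges agree. -/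
theorem HasConfEdge.iff_of_subset {S : Spacetime n X} {g h B : Set X} (hg : S.HasConfEdge g B)
    (hgh : g ⊆ h) : S.HasConfEdge h B ↔ S.confEdge h = S.confEdge g := by
  -- Once `domDep B` is replaced by `confEdge g`, only `B ⊆ footprint h` is left over, and it is
  -- inherited from `g`.
  rw [HasConfEdge, ← hg.2]
  exact and_iff_right (hg.1.trans (S.footprint_mono hgh))

end Spacetime

namespace Matter

variable {n : ℕ} {X : Type*} [TopologicalSpace X]
    [ChartedSpace (EuclideanHalfSpace (n + 2)) X] [IsManifold (𝓡∂ (n + 2)) ∞ X]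
    {S : Spacetime n X}
    {H : Type*} [NormedAddCommGroup H] [InnerProductSpace ℂ H] [CompleteSpace H]
    (Q : Matter S H)

/-- For a wedge `a` anchored at `B`, the family `G(a)` consists of the members of `G(B)` that
contain `a`. -/
theorem mem_bulkFamily_iff {a B : Set X} (haB : S.HasConfEdge a B) {g : Set X} :
    g ∈ Q.bulkFamily a ↔ a ⊆ g ∧ g ∈ Q.bdryFamily B := by
  constructor
  · rintro ⟨hw, ⟨hag, he⟩, hn, C, hC, hmin⟩
    have hg : S.HasConfEdge g B := (haB.iff_of_subset hag).2 he
    refine ⟨hag, hw, hg, hn, C, hC, fun h hh hne hgh hhB hhC hc ↦ ?_⟩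
    -- The same slice `C` works for both families. Anchoring of `h` at `B` supplies the equality of
    -- conformal edges, which upgrades boundedness from the bulk edges to the completed ones.
    exact hmin h hh hne hgh hhC
      ((S.compactInBulk_fullEdge_diff_iff hgh).2 ⟨(hg.iff_of_subset hgh).1 hhB, hc⟩)
  · rintro ⟨hag, hw, hg, hn, C, hC, hmin⟩
    refine ⟨hw, ⟨hag, (haB.iff_of_subset hag).1 hg⟩, hn, C, hC, fun h hh hne hgh hhC hc ↦ ?_⟩
    -- Here `h` is not assumed to be anchored; its anchoring at `B` is extracted from the
    -- boundedness of the completed difference.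
    obtain ⟨he, hc'⟩ := (S.compactInBulk_fullEdge_diff_iff hgh).1 hc
    exact hmin h hh hne hgh ((hg.iff_of_subset hgh).2 he) hhC hc'

end Matter

end Holo

theorem mainTheorem9 {n : ℕ} {X : Type*} [TopologicalSpace X] [T2Space X]
    [SecondCountableTopology X] [ChartedSpace (EuclideanHalfSpace (n + 2)) X]
    [IsManifold (𝓡∂ (n + 2)) ∞ X]
    (S : Holo.Spacetime n X) (hS : S.IsAsymptoticallyAdS)
    {H : Type*} [NormedAddCommGroup H] [InnerProductSpace ℂ H] [CompleteSpace H]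
    (Q : Holo.Matter S H)
    (a : Set X) (ha : S.IsWedge a)
    (B : Set X) (hB : S.IsSpatialRegion B) (haB : S.HasConfEdge a B)
    (h : a ⊆ Q.minEW B) :
    Q.bulkFamily a = Q.bdryFamily B ∧ Q.eMin a = Q.minEW B := by
  have hG : Q.bulkFamily a = Q.bdryFamily B := by
    ext g
    rw [Q.mem_bulkFamily_iff haB]
    exact and_iff_right_of_imp fun hg x hx ↦ (h hx).2 g hg
  -- Both intersections are taken inside the bulk, so an empty family needs no separate case.
  exact ⟨hG, by rw [Holo.Matter.eMin, Holo.Matter.minEW, hG]⟩
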